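/- **Corollary (Separation implies different trees).** Let $f$ be a probability density on $\mathbb{R}^d$ supported on a compact set $\mathcal{X}\subset\mathbb{R}^d$ ($f=0$ off $\mathcal{X}$) with $|f(x)-f(x')|\le C_\alpha\|x-x'\|^\alpha$ for all $x,x'\in\mathcal{X}$, where $0<\alpha\le 1$ and $C_\alpha>0$. Let $K(u)=k(\|u\|)$, with $k:[0,\infty)\to[0,\infty)$ non-increasing, $\int_{\mathbb{R}^d} K=1$, and $k(t)\le C_\rho e^{-t^\rho}$ for all $t>t_0$, for some constants $\rho,C_\rho,t_0>0$. Let $h=h(n)>0$ satisfy $h\to0$ and $\frac{\log n}{n h^d}\to 0$ as $n\to\infty$. *Definitions.* $B(x,r)$ is the open Euclidean ball in $\mathbb{R}^d$. A point $x_0\in\mathcal{X}$ is a *mode* of $f$ if there is $r_M>0$ such that $x_0$ is the unique maximizer of $f$ in $B(x_0,r_M)$ and, for some $\check C,\hat C>0$, $\check C\|x-x_0\|^2\le f(x_0)-f(x)\le\hat C\|x-x_0\|^2$ for all $x\in B(x_0,r_M)$. Points $x_1,x_2\in\mathcal{X}$ are *$(r,\delta)$-separated* if there is $S\subset\mathcal{X}$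 such that every continuous path from $x_1$ to $x_2$ in the convex hull of $\mathcal{X}$ (which is $\mathcal{X}$ itself when $\mathcal{X}$ is convex) meets $S$, and $$\sup_{x\in S+B(0,r)} f(x)\;<\;\inf_{x\in B(x_1,r)\cup B(x_2,r)} f(x)\;-\;\delta .$$ For data $X_1,\dots,X_n$ let $\hat f_h(q)=\frac{1}{nh^d}\sum_{i=1}^n K\big(\frac{q-X_i}{h}\big)$. A *KDE oracle with error $\epsilon>0$* returns values $\tilde f(q)$ such that, provided $h\ge(\log n/n)^{1/d}$, with probability at least $1-1/n$ one has $(1-\epsilon)\hat f_h(q)\le\tilde f(q)\le(1+\epsilon)\hat f_h(q)$ simultaneously for all $q\in\mathcal{X}$. The *Quick Shift graph* $G$, for a search radius $r>0$, an approximation factor $c\ge1$ and an integer $k\ge 0$, is the directed graph on the sample points in which each $X_i$ queries a $(k,c,r)$-approximate near neighbour structure (which returns data points within distance $cr$ of $X_i$, and at least $k$ of them if at least $k$ data points are within distance $r$ of $X_i$), takes a maximizer $\hat x_i$ of $\tilde f$ among the returned points, and gets an edge $X_i\to\hat x_i$ if and only if $\tilde f(\hat x_i)>\tilde f(X_i)$.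 A *root* (estimated mode) is a vertex without outgoing edge; its *tree* consists of all vertices from which there is a directed path, possibly of length zero, to it. For a separation width $r_s>0$, a *Quick Shift tree rooted at the mode $x_0$* is the tree of a root at distance less than $r_s$ from $x_0$. *Claim.* There is a constant $C>0$ such that for all $r_s,\delta>0$ there is $N$ such that for all $n\ge N$ the following holds. Let $X_1,\dots,X_n$ be i.i.d. with density $f$, let $\epsilon>0$, let $\tilde f$ be the values of a KDE oracle with error $\epsilon$, and let $G$ be a Quick Shift graph built from $\tilde f$ with parameters $k$, $c\ge1$, $r>0$ such that $cr<r_s/2$. Then, with probability at least $1-2/n$: if $\delta>C\,\epsilon\,\sup_{x\in\mathcal{X}}\hat f_h(x)$, then for every mode $x_0$ of $f$ and every sample point $x$ such that $x$ and $x_0$ are $(r_s,\delta)$-separated, $x$ does not lie in any Quick Shift tree rooted at $x_0$. -/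

import Mathlib

open MeasureTheory ProbabilityTheory Filter Topology
open scoped Pointwise

universe u

/-- `ℝ^d` with its Euclidean norm and Lebesgue measure. -/
abbrev Eucl (d : ℕ) : Type := EuclideanSpace ℝ (Fin d)

/-- `f` is a probability density on `ℝ^d` that is supported on `𝒳` (it is `0` off `𝒳`). -/
structure IsDensityOn {d : ℕ} (f : Eucl d → ℝ) (𝒳 : Set (Eucl d)) : Prop where
  measurable : Measurable f
  nonneg : ∀ x, 0 ≤ f x
  eq_zero_off : ∀ x, x ∉ 𝒳 → f x = 0
  integral_eq_one : ∫ x, f x = 1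

/-- The kernel assumption: `K u = k ‖u‖` with `k ≥ 0` non-increasing on `[0, ∞)`, `∫ K = 1`, and
`k t ≤ C_ρ exp (-t ^ ρ)` for all `t > t₀`. -/
def IsRadialKernel {d : ℕ} (K : Eucl d → ℝ) : Prop :=
  ∃ k : ℝ → ℝ,
    (∀ t, 0 ≤ t → 0 ≤ k t) ∧ AntitoneOn k (Set.Ici 0) ∧ (∀ u, K u = k ‖u‖) ∧
    (∫ u, K u = 1) ∧
    ∃ ρ Cρ t₀ : ℝ, 0 < ρ ∧ 0 < Cρ ∧ 0 < t₀ ∧ ∀ t, t₀ < t → k t ≤ Cρ * Real.exp (-(t ^ ρ))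

/-- The kernel density estimator with bandwidth `h` of the points `x 0, …, x (n - 1)`. -/
noncomputable def kde {d n : ℕ} (K : Eucl d → ℝ) (h : ℝ) (x : Fin n → Eucl d) (q : Eucl d) : ℝ :=
  1 / (n * h ^ d) * ∑ i, K (h⁻¹ • (q - x i))

/-- "With probability at least `p`, `Q` holds": `Q` holds on an event of probability at least `p`.
(`Q` itself need not be a measurable set.) -/
def HoldsWithProb {Ω : Type u} [MeasurableSpace Ω] (P : Measure Ω) (p : ℝ) (Q : Ω → Prop) : Prop :=
  ∃ A : Set Ω, MeasurableSet A ∧ ENNReal.ofReal p ≤ P A ∧ ∀ ω ∈ A, Q ω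

/-- The guarantee of the approximate KDE oracle run with error `ε` on the random data
`X 0, …, X (n - 1)`: provided `h ≥ (log n / n) ^ (1 / d)`, with probability at least `1 - 1 / n`
its answers `ftilde q` are within a factor `1 ± ε` of the KDE, for all queries `q ∈ 𝒳`. The
randomness of the oracle lives on the same probability space; its dependence on the data is
arbitrary. -/
def IsKDEOracle {d n : ℕ} {Ω : Type u} [MeasurableSpace Ω] (P : Measure Ω) (𝒳 : Set (Eucl d))
    (K : Eucl d → ℝ) (h ε : ℝ) (X : Fin n → Ω → Eucl d) (ftilde : Ω → Eucl d → ℝ) : Prop :=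
  (Real.log n / n) ^ ((1 : ℝ) / d) ≤ h →
    HoldsWithProb P (1 - 1 / n) fun ω => ∀ q ∈ 𝒳,
      (1 - ε) * kde K h (fun i => X i ω) q ≤ ftilde ω q ∧
      ftilde ω q ≤ (1 + ε) * kde K h (fun i => X i ω) q

/-- `x₀` is a mode of `f`: the unique maximizer of `f` in some ball `B(x₀, r_M)`, on which
`f x₀ - f x` is bounded above and below by positive multiples of `‖x - x₀‖²`. -/
def IsMode {d : ℕ} (f : Eucl d → ℝ) (𝒳 : Set (Eucl d)) (x₀ : Eucl d) : Prop :=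
  x₀ ∈ 𝒳 ∧ ∃ rM : ℝ, 0 < rM ∧
    (∀ x ∈ Metric.ball x₀ rM, x ≠ x₀ → f x < f x₀) ∧
    ∃ Cl Cu : ℝ, 0 < Cl ∧ 0 < Cu ∧ ∀ x ∈ Metric.ball x₀ rM,
      Cl * ‖x - x₀‖ ^ 2 ≤ f x₀ - f x ∧ f x₀ - f x ≤ Cu * ‖x - x₀‖ ^ 2

/-- `(r, δ)`-separation of two points of `𝒳`. The paths are the continuous paths in the convex
hull of `𝒳` (that is, in `𝒳` itself when `𝒳` is convex). -/
def IsSeparated {d : ℕ} (f : Eucl d → ℝ) (𝒳 : Set (Eucl d)) (r δ : ℝ) (x₁ x₂ : Eucl d) : Prop :=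
  x₁ ∈ 𝒳 ∧ x₂ ∈ 𝒳 ∧ ∃ S : Set (Eucl d), S ⊆ 𝒳 ∧
    (∀ γ : Path x₁ x₂, (∀ t, γ t ∈ convexHull ℝ 𝒳) → ∃ t, γ t ∈ S) ∧
    sSup (f '' (S + Metric.ball 0 r)) <
      sInf (f '' (Metric.ball x₁ r ∪ Metric.ball x₂ r)) - δ

/-- `A` is a valid answer of a `(k, c, r)`-approximate near neighbour data structure to the query
`q` on the data `x 0, …, x (n - 1)`: only points within distance `c * r` of `q` are returned, and
at least `k` of them if at least `k` data points lie within distance `r` of `q`. (For `c = 1`, the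
set of all data points in the closed `r`-ball around `q` is such an answer.) -/
def IsANNSAnswer {d n : ℕ} (x : Fin n → Eucl d) (k : ℕ) (c r : ℝ) (q : Eucl d)
    (A : Finset (Fin n)) : Prop :=
  (∀ j ∈ A, dist q (x j) ≤ c * r) ∧ (k ≤ {j : Fin n | dist q (x j) ≤ r}.ncard → k ≤ A.card)

/-- `G` is a possible output of Quick Shift with density values `g` on the data
`x 0, …, x (n - 1)`: for each `i` a near neighbour query returns a set `nbr i`, `top i` maximizes
`g` over it (ties are broken arbitrarily), and there is an edge from `i` to `top i` precisely when
`g` is larger there; there are no other edges. -/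
def IsQuickShiftGraph {d n : ℕ} (x : Fin n → Eucl d) (g : Eucl d → ℝ) (k : ℕ) (c r : ℝ)
    (G : Digraph (Fin n)) : Prop :=
  ∃ (nbr : Fin n → Finset (Fin n)) (top : Fin n → Fin n),
    (∀ i, IsANNSAnswer x k c r (x i) (nbr i)) ∧
    (∀ i, (nbr i).Nonempty → top i ∈ nbr i ∧ ∀ j ∈ nbr i, g (x j) ≤ g (x (top i))) ∧
    ∀ i j, G.Adj i j ↔ ((nbr i).Nonempty ∧ j = top i ∧ g (x i) < g (x j))

/-- Vertex `i` lies in the tree of `G` rooted at `j`: `j` is a root (it has no outgoing edge) and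
there is a directed path, possibly of length `0`, from `i` to `j`. -/
def InTreeRootedAt {n : ℕ} (G : Digraph (Fin n)) (i j : Fin n) : Prop :=
  (∀ l, ¬ G.Adj j l) ∧ Relation.ReflTransGen G.Adj i j

/-!
The proof combines a uniform deviation bound for the kernel density estimator with a short
deterministic argument about paths.

*Uniform consistency* (`kde_uniform_consistency`). Write `K u = κ ‖u‖` with `κ` antitone. For
`‖q - c‖ ≤ τ h` the estimator at `q` lies between the estimators at `c` with the shifted profiles
`κ (· + τ)` and `κ (· - τ)`. This replaces any smoothness of the kernel: an antitone function has
countably many discontinuities, so the two shifted kernels have integrals close to `1` for a small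
fixed `τ` (`tendsto_integral_shift`), and it suffices to control them at the points `c` of a
`τ h`-net of the support. Such a net has `O(h ^ (-d)) = O(n)` points (`exists_net`). At each of them
the deviation from the mean has probability `exp (-const * n h ^ d) ≤ n ^ (-3)` by a Chernoff bound
(`measureReal_average_deviation_le`), because `n h ^ d` dominates `log n`, and a union bound gives
total failure probability at most `1 / n`. The mean is compared with the density by the uniform
continuity of `f` on its support (`bias_bounds`). Since `f` may jump to `0` at the boundary of the
support, the comparison from below is only claimed away from the boundary; the comparison from above
holds everywhere on the support.

*Separation* (`not_reachable_of_isSeparated`). If the tree of `X j` contains `X i` and `X j` is near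
the mode `x₀`, join `X i` to `X j` by the segments along a directed path, and `X j` to `x₀` by a
segment. This stays in the convex hull of the support, so it meets the barrier `S`. The last segment
does not, as it stays within `rs` of `x₀`, where `f` is large. So `S` meets an edge, and since edges
are shorter than `rs / 2`, some vertex `X a` of the path satisfies `f (X a) < f (X i) - δ`. The
values of `ftilde` do not decrease along the path, so this contradicts consistency as soon as the
oracle error is less than `δ / 4`, which is where `C = 4` comes from. The lower bound for the
estimator is needed at `X i` only, and the ball `B(X i, rs)` lies in the support because `f` is
positive on it.
-/

/-! ### Nets of bounded sets -/

lemma card_mul_pow_le_of_separated {d : ℕ} {R ε : ℝ} (hR : 0 ≤ R) (hε : 0 < ε) (hε1 : ε ≤ 1)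
    (t : Finset (Eucl d)) (hsub : (t : Set (Eucl d)) ⊆ Metric.closedBall 0 R)
    (hsep : (t : Set (Eucl d)).Pairwise fun x y => ε < dist x y) :
    t.card * ε ^ d ≤ (2 * R + 2) ^ d := by
  have hdisj : (t : Set (Eucl d)).PairwiseDisjoint fun x => Metric.ball x (ε / 2) :=
    fun x hx y hy hxy => Metric.ball_disjoint_ball (by linarith [hsep hx hy hxy])
  have hvol := measure_biUnion_finset (μ := (volume : Measure (Eucl d))) hdisj
    fun _ _ => measurableSet_ball
  have hle : volume (⋃ x ∈ t, Metric.ball x (ε / 2)) ≤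
      volume (Metric.ball (0 : Eucl d) (R + 1)) := by
    refine measure_mono (Set.iUnion₂_subset fun x hx => ?_)
    have h1 : dist x 0 ≤ R := hsub hx
    exact Metric.ball_subset_ball' (by linarith)
  have hb : ∀ (x : Eucl d) {r : ℝ}, 0 < r → volume.real (Metric.ball x r) =
      r ^ d * volume.real (Metric.ball (0 : Eucl d) 1) := by
    intro x r hr
    rw [measureReal_def, Measure.addHaar_ball_of_pos _ _ hr, ENNReal.toReal_mul,
      ENNReal.toReal_ofReal (by positivity), finrank_euclideanSpace_fin, measureReal_def]
  have hpos : 0 < volume.real (Metric.ball (0 : Eucl d) 1) :=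
    ENNReal.toReal_pos (Metric.measure_ball_pos _ _ one_pos).ne' measure_ball_lt_top.ne
  have hle' : ∑ x ∈ t, volume.real (Metric.ball x (ε / 2)) ≤
      volume.real (Metric.ball (0 : Eucl d) (R + 1)) := by
    rw [hvol] at hle
    have := ENNReal.toReal_mono measure_ball_lt_top.ne hle
    rwa [ENNReal.toReal_sum fun _ _ => measure_ball_lt_top.ne] at this
  rw [Finset.sum_congr rfl fun x _ => hb x (by positivity : 0 < ε / 2), Finset.sum_const,
    hb 0 (by positivity : 0 < R + 1), nsmul_eq_mul, ← mul_assoc] at hle'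
  have h2 := le_of_mul_le_mul_right hle' hpos
  calc (t.card : ℝ) * ε ^ d = t.card * (ε / 2) ^ d * 2 ^ d := by
        rw [mul_assoc, ← mul_pow]; congr 2; ring
    _ ≤ (R + 1) ^ d * 2 ^ d := by gcongr
    _ = (2 * R + 2) ^ d := by rw [← mul_pow]; congr 1; ring

/-- A bounded set has an `ε`-net in it of cardinality `O(ε ^ (-d))`: a separated subset of maximal
cardinality. -/
lemma exists_net {d : ℕ} {R ε : ℝ} (hR : 0 ≤ R) (hε : 0 < ε) (hε1 : ε ≤ 1)
    {s : Set (Eucl d)} (hs : s ⊆ Metric.closedBall 0 R) :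
    ∃ t : Finset (Eucl d), (t : Set (Eucl d)) ⊆ s ∧ (∀ x ∈ s, ∃ c ∈ t, dist x c ≤ ε) ∧
      t.card * ε ^ d ≤ (2 * R + 2) ^ d := by
  classical
  let p : ℕ → Prop := fun m => ∃ t : Finset (Eucl d), (t : Set (Eucl d)) ⊆ s ∧
    ((t : Set (Eucl d)).Pairwise fun x y => ε < dist x y) ∧ t.card = m
  have hbd : ∀ m, p m → m ≤ ⌈(2 * R + 2) ^ d / ε ^ d⌉₊ := by
    rintro m ⟨t, ht, hsep, rfl⟩
    have h1 := card_mul_pow_le_of_separated hR hε hε1 t (ht.trans hs) hsep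
    rw [← le_div_iff₀ (by positivity)] at h1
    exact_mod_cast h1.trans (Nat.le_ceil _)
  have h0 : p 0 := ⟨∅, by simp, by simp, rfl⟩
  obtain ⟨t, ht, hsep, hcard⟩ : p (Nat.findGreatest p ⌈(2 * R + 2) ^ d / ε ^ d⌉₊) :=
    Nat.findGreatest_spec (Nat.zero_le _) h0
  refine ⟨t, ht, fun x hx => ?_, card_mul_pow_le_of_separated hR hε hε1 t (ht.trans hs) hsep⟩
  by_contra! hcon
  have hxt : x ∉ t := fun hxt => by simpa [hε.not_gt] using hcon x hxt
  have hp : p (t.card + 1) := by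
    refine ⟨insert x t, ?_, ?_, Finset.card_insert_of_notMem hxt⟩
    · rw [Finset.coe_insert]
      exact Set.insert_subset hx ht
    · rw [Finset.coe_insert]
      refine hsep.insert fun y hy _ => ⟨hcon y hy, ?_⟩
      rw [dist_comm]
      exact hcon y hy
  have := Nat.le_findGreatest (hbd _ hp) hp
  omega

/-! ### A Chernoff bound -/

/-- For `|s| b ≤ 1` this follows from `exp x ≤ 1 + x + x²` on `[-1, 1]` and `Y² ≤ b Y`. -/
lemma mgf_le_exp_of_mem_Icc {Ω : Type u} [MeasurableSpace Ω] {P : Measure Ω}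
    [IsProbabilityMeasure P] {Y : Ω → ℝ} (hY : Measurable Y) {b s : ℝ}
    (h0 : ∀ ω, 0 ≤ Y ω) (hb : ∀ ω, Y ω ≤ b) (hs : |s| * b ≤ 1) :
    Integrable (fun ω => Real.exp (s * Y ω)) P ∧
    mgf Y P s ≤ Real.exp (s * P[Y] + s ^ 2 * b * P[Y]) := by
  have habs : ∀ ω, |s * Y ω| ≤ 1 := fun ω => by
    rw [abs_mul, abs_of_nonneg (h0 ω)]
    exact (mul_le_mul_of_nonneg_left (hb ω) (abs_nonneg s)).trans hs
  have hYint : Integrable Y P := Integrable.of_bound hY.aestronglyMeasurable b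
    (ae_of_all _ fun ω => by rw [Real.norm_eq_abs, abs_of_nonneg (h0 ω)]; exact hb ω)
  have hint : Integrable (fun ω => Real.exp (s * Y ω)) P :=
    Integrable.of_bound (by fun_prop) (Real.exp 1)
      (ae_of_all _ fun ω => by
        rw [Real.norm_eq_abs, abs_of_pos (Real.exp_pos _)]
        exact Real.exp_le_exp.2 ((le_abs_self _).trans (habs ω)))
  refine ⟨hint, ?_⟩
  calc mgf Y P s ≤ ∫ ω, (1 + (s + s ^ 2 * b) * Y ω) ∂P := by
        refine integral_mono hint ((integrable_const _).add (hYint.const_mul _)) fun ω => ?_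
        have h1 := (abs_le.1 (Real.abs_exp_sub_one_sub_id_le (habs ω))).2
        have h2 : s ^ 2 * (Y ω * Y ω) ≤ s ^ 2 * (b * Y ω) := by
          gcongr
          exacts [h0 ω, hb ω]
        dsimp only
        nlinarith
    _ = 1 + (s + s ^ 2 * b) * P[Y] := by
        rw [integral_add (integrable_const _) (hYint.const_mul _), integral_const_mul]
        simp
    _ ≤ _ := by
        rw [← add_mul, add_comm]
        exact Real.add_one_le_exp _

/-- Chernoff bound for an average of independent variables with values in `[0, b]` and common
mean at most `M`. It keeps the first power of `b` in the exponent (as in Bernstein's inequality),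
which is what a kernel estimator with `b` of order `h ^ (-d)` needs. -/
lemma measureReal_average_deviation_le {Ω : Type u} [MeasurableSpace Ω] {P : Measure Ω}
    [IsProbabilityMeasure P] {n : ℕ} (hn : 0 < n) {Y : Fin n → Ω → ℝ}
    (hY : ∀ i, Measurable (Y i)) (hind : iIndepFun Y P) {b m M η θ : ℝ} (hb0 : 0 < b)
    (h0 : ∀ i ω, 0 ≤ Y i ω) (hb : ∀ i ω, Y i ω ≤ b) (hm : ∀ i, P[Y i] = m) (hmM : m ≤ M)
    (hθ : 0 ≤ θ) (hθ1 : θ ≤ 1) (hθM : θ * M ≤ η / 2) :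
    P.real {ω | m + η ≤ 1 / n * ∑ i, Y i ω} ≤ Real.exp (-(n * θ * η / (2 * b))) ∧
    P.real {ω | 1 / n * ∑ i, Y i ω ≤ m - η} ≤ Real.exp (-(n * θ * η / (2 * b))) := by
  have hn' : (0 : ℝ) < n := by exact_mod_cast hn
  have hs : |θ / b| * b ≤ 1 := by
    rw [abs_of_nonneg (by positivity)]
    field_simp
    exact hθ1
  have key : ∀ s : ℝ, |s| * b ≤ 1 → Integrable (fun ω => Real.exp (s * (∑ i, Y i) ω)) P ∧
      mgf (∑ i, Y i) P s ≤ Real.exp (n * (s * m + s ^ 2 * b * m)) := by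
    intro s hs
    refine ⟨hind.integrable_exp_mul_sum hY
      fun i _ => (mgf_le_exp_of_mem_Icc (hY i) (h0 i) (hb i) hs).1, ?_⟩
    rw [hind.mgf_sum hY]
    calc ∏ i, mgf (Y i) P s ≤ ∏ _i : Fin n, Real.exp (s * m + s ^ 2 * b * m) := by
          refine Finset.prod_le_prod (fun _ _ => mgf_nonneg) fun i _ => ?_
          have := (mgf_le_exp_of_mem_Icc (P := P) (hY i) (h0 i) (hb i) hs).2
          rwa [hm i] at this
      _ = _ := by rw [Finset.prod_const, ← Real.exp_nat_mul]; simp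
  have hfin : n * ((θ / b) ^ 2 * b * m - θ / b * η) ≤ -(n * θ * η / (2 * b)) := by
    have h1 : (n : ℝ) * ((θ / b) ^ 2 * b * m - θ / b * η) =
        n * θ / b * (θ * m - η) := by field_simp
    have h2 : -(n * θ * η / (2 * b)) = n * θ / b * (-(η / 2)) := by field_simp
    rw [h1, h2]
    have : θ * m ≤ θ * M := by gcongr
    exact mul_le_mul_of_nonneg_left (by linarith) (by positivity)
  constructor
  · have hset : {ω | m + η ≤ 1 / n * ∑ i, Y i ω} = {ω | n * (m + η) ≤ (∑ i, Y i) ω} := by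
      ext ω
      simp only [Set.mem_ofPred_eq, Finset.sum_apply]
      rw [one_div, ← div_eq_inv_mul, le_div_iff₀ hn', mul_comm]
    rw [hset]
    refine (measure_ge_le_exp_mul_mgf _ (by positivity : 0 ≤ θ / b) (key _ hs).1).trans ?_
    refine (mul_le_mul_of_nonneg_left (key _ hs).2 (Real.exp_pos _).le).trans ?_
    rw [← Real.exp_add, Real.exp_le_exp]
    refine le_trans (le_of_eq ?_) hfin
    ring
  · have hset : {ω | 1 / n * ∑ i, Y i ω ≤ m - η} = {ω | (∑ i, Y i) ω ≤ n * (m - η)} := by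
      ext ω
      simp only [Set.mem_ofPred_eq, Finset.sum_apply]
      rw [one_div, ← div_eq_inv_mul, div_le_iff₀ hn', mul_comm (m - η)]
    have hs' : |(-(θ / b))| * b ≤ 1 := by rwa [abs_neg]
    rw [hset]
    refine (measure_le_le_exp_mul_mgf _ (neg_nonpos.2 (by positivity : 0 ≤ θ / b))
      (key _ hs').1).trans ?_
    refine (mul_le_mul_of_nonneg_left (key _ hs').2 (Real.exp_pos _).le).trans ?_
    rw [← Real.exp_add, Real.exp_le_exp]
    refine le_trans (le_of_eq ?_) hfin
    ring

/-! ### Radial kernels with a shifted profile -/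

section Shift

variable {d : ℕ} {κ : ℝ → ℝ} {B : ℝ}

lemma integrable_shift (hκ : Antitone κ) (h0 : ∀ t, 0 ≤ κ t) (hB : ∀ t, κ t ≤ B)
    (hint : Integrable fun u : Eucl d => κ ‖u‖) {s : ℝ} (hs : -1 ≤ s) :
    Integrable fun u : Eucl d => κ (‖u‖ + s) := by
  have h1 : Integrable fun u : Eucl d => κ ‖(1 / 2 : ℝ) • u‖ :=
    hint.comp_smul (by norm_num)
  have h2 : Integrable ((Metric.closedBall (0 : Eucl d) 2).indicator fun _ => B) :=
    (integrable_indicator_iff measurableSet_closedBall).2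
      (integrableOn_const (by exact measure_closedBall_lt_top.ne))
  refine (h2.add h1).mono' (hκ.measurable.comp (by fun_prop)).aestronglyMeasurable
    (ae_of_all _ fun u => ?_)
  rw [Real.norm_eq_abs, abs_of_nonneg (h0 _), Pi.add_apply]
  by_cases hu : u ∈ Metric.closedBall (0 : Eucl d) 2
  · rw [Set.indicator_of_mem hu]
    linarith [hB (‖u‖ + s), h0 ‖(1 / 2 : ℝ) • u‖]
  · rw [Set.indicator_of_notMem hu, zero_add]
    refine hκ ?_
    rw [mem_closedBall_zero_iff, not_le] at hu
    rw [norm_smul, Real.norm_of_nonneg (by norm_num)]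
    linarith

/-- A monotone profile has at most countably many discontinuities, and spheres are null sets, so
dominated convergence applies. -/
lemma tendsto_integral_shift (hd : d ≠ 0) (hκ : Antitone κ) (h0 : ∀ t, 0 ≤ κ t)
    (hB : ∀ t, κ t ≤ B) (hint : Integrable fun u : Eucl d => κ ‖u‖) :
    Tendsto (fun s : ℝ => ∫ u : Eucl d, κ (‖u‖ + s)) (𝓝 0) (𝓝 (∫ u : Eucl d, κ ‖u‖)) := by
  have : NeZero d := ⟨hd⟩
  have : Nontrivial (Eucl d) := inferInstance
  refine tendsto_integral_filter_of_dominated_convergence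
    (fun u : Eucl d => κ (‖u‖ + -1)) ?_ ?_ (integrable_shift hκ h0 hB hint le_rfl) ?_
  · exact Eventually.of_forall fun s => (hκ.measurable.comp (by fun_prop)).aestronglyMeasurable
  · filter_upwards [eventually_ge_nhds (show (-1 : ℝ) < 0 by norm_num)] with s hs
    refine ae_of_all _ fun u => ?_
    rw [Real.norm_eq_abs, abs_of_nonneg (h0 _)]
    exact hκ (by linarith)
  · have hnull : ∀ᵐ u : Eucl d, ContinuousAt κ ‖u‖ := by
      have hc := hκ.countable_not_continuousAt
      have hsub : {u : Eucl d | ¬ ContinuousAt κ ‖u‖} ⊆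
          ⋃ t ∈ {t | ¬ ContinuousAt κ t}, Metric.sphere (0 : Eucl d) t := fun u hu =>
        Set.mem_biUnion (x := ‖u‖) hu (by simp)
      exact measure_mono_null hsub ((measure_biUnion_null_iff hc).2 fun t _ =>
        Measure.addHaar_sphere _ _ _)
    filter_upwards [hnull] with u hu
    have h1 : Tendsto (fun s : ℝ => ‖u‖ + s) (𝓝 0) (𝓝 ‖u‖) :=
      (show Continuous fun s : ℝ => ‖u‖ + s by fun_prop).tendsto' 0 _ (add_zero _)
    exact hu.tendsto.comp h1

lemma tendsto_setIntegral_norm_gt {φ : Eucl d → ℝ} (hφ : Integrable φ) :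
    Tendsto (fun R : ℝ => ∫ u in {u : Eucl d | R < ‖u‖}, φ u) atTop (𝓝 0) := by
  have hmeas : ∀ R : ℝ, MeasurableSet {u : Eucl d | R < ‖u‖} := fun R =>
    measurableSet_lt measurable_const measurable_norm
  have h := tendsto_integral_filter_of_dominated_convergence (l := atTop) (μ := volume)
    (F := fun (R : ℝ) u => {u : Eucl d | R < ‖u‖}.indicator φ u) (f := fun _ => (0 : ℝ))
    (fun u => ‖φ u‖)
    (Eventually.of_forall fun R => (hφ.indicator (hmeas R)).aestronglyMeasurable)
    (Eventually.of_forall fun R => ae_of_all _ fun u => norm_indicator_le_norm_self _ _)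
    hφ.norm
    (ae_of_all _ fun u => by
      refine tendsto_const_nhds.congr' ?_
      filter_upwards [eventually_ge_atTop ‖u‖] with R hR
      exact (Set.indicator_of_notMem (by simpa using hR) _).symm)
  simp only [integral_zero] at h
  exact h.congr fun R => integral_indicator (hmeas R)

end Shift

/-! ### Bias of a kernel average -/

section Bias

variable {d : ℕ} {φ f : Eucl d → ℝ} {h R a M : ℝ} {c : Eucl d}

lemma integral_rescale (φ : Eucl d → ℝ) (hh : 0 < h) (c : Eucl d) :
    ∫ y, (h ^ d)⁻¹ * φ (h⁻¹ • (c - y)) = ∫ u, φ u := by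
  rw [integral_const_mul, integral_sub_left_eq_self (fun y => φ (h⁻¹ • y)) volume c,
    Measure.integral_comp_inv_smul_of_nonneg volume _ hh.le, finrank_euclideanSpace_fin,
    smul_eq_mul, ← mul_assoc, inv_mul_cancel₀ (by positivity), one_mul]

lemma integrable_rescale (hφ : Integrable φ) (hh : 0 < h) (c : Eucl d) :
    Integrable fun y => (h ^ d)⁻¹ * φ (h⁻¹ • (c - y)) :=
  ((hφ.comp_smul (inv_ne_zero hh.ne')).comp_sub_left c).const_mul _

lemma norm_sub_le_of_rescale {y : Eucl d} (hh : 0 < h) (hy : ¬ R < ‖h⁻¹ • (c - y)‖) :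
    ‖y - c‖ ≤ R * h := by
  rw [not_lt, norm_smul, Real.norm_of_nonneg (by positivity), ← div_eq_inv_mul,
    div_le_iff₀ hh, norm_sub_rev] at hy
  exact hy

lemma integrable_rescale_mul (hφ : Integrable φ) (hh : 0 < h) (hf : Measurable f)
    (hf0 : ∀ x, 0 ≤ f x) (hfM : ∀ x, f x ≤ M) :
    Integrable fun y => (h ^ d)⁻¹ * φ (h⁻¹ • (c - y)) * f y :=
  (integrable_rescale hφ hh c).mul_bdd hf.aestronglyMeasurable
    (ae_of_all _ fun y => by rw [Real.norm_eq_abs, abs_of_nonneg (hf0 y)]; exact hfM y)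

/-- An upper bound `a` for `f` in the ball `B(c, R h)` passes to the kernel average, up to the mass of
the kernel outside `B(0, R)`. -/
lemma integral_rescale_mul_le (hφ : Integrable φ) (hφ0 : ∀ u, 0 ≤ φ u) (hh : 0 < h)
    (hf : Measurable f) (hf0 : ∀ x, 0 ≤ f x) (hfM : ∀ x, f x ≤ M) (ha : 0 ≤ a)
    (hfa : ∀ y, ‖y - c‖ ≤ R * h → f y ≤ a) :
    ∫ y, (h ^ d)⁻¹ * φ (h⁻¹ • (c - y)) * f y ≤
      a * (∫ u, φ u) + M * ∫ u in {u | R < ‖u‖}, φ u := by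
  have hmeas : MeasurableSet {u : Eucl d | R < ‖u‖} :=
    measurableSet_lt measurable_const measurable_norm
  have hi := hφ.indicator hmeas
  rw [← integral_indicator hmeas, ← integral_rescale φ hh c,
    ← integral_rescale ({u : Eucl d | R < ‖u‖}.indicator φ) hh c, ← integral_const_mul,
    ← integral_const_mul, ← integral_add ((integrable_rescale hφ hh c).const_mul _)
      ((integrable_rescale hi hh c).const_mul _)]
  refine integral_mono (integrable_rescale_mul hφ hh hf hf0 hfM)
    (((integrable_rescale hφ hh c).const_mul _).add ((integrable_rescale hi hh c).const_mul _))
    fun y => ?_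
  have hw : 0 ≤ (h ^ d)⁻¹ * φ (h⁻¹ • (c - y)) := mul_nonneg (by positivity) (hφ0 _)
  dsimp only
  by_cases hy : R < ‖h⁻¹ • (c - y)‖
  · rw [Set.indicator_of_mem (s := {u : Eucl d | R < ‖u‖}) hy]
    nlinarith [hfM y]
  · rw [Set.indicator_of_notMem (s := {u : Eucl d | R < ‖u‖}) hy]
    nlinarith [hfa y (norm_sub_le_of_rescale hh hy)]

lemma le_integral_rescale_mul (hφ : Integrable φ) (hφ0 : ∀ u, 0 ≤ φ u) (hh : 0 < h)
    (hf : Measurable f) (hf0 : ∀ x, 0 ≤ f x) (hfM : ∀ x, f x ≤ M)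
    (hfa : ∀ y, ‖y - c‖ ≤ R * h → a ≤ f y) :
    a * (∫ u, φ u) - a * (∫ u in {u | R < ‖u‖}, φ u) ≤
      ∫ y, (h ^ d)⁻¹ * φ (h⁻¹ • (c - y)) * f y := by
  have hmeas : MeasurableSet {u : Eucl d | R < ‖u‖} :=
    measurableSet_lt measurable_const measurable_norm
  have hi := hφ.indicator hmeas
  rw [← integral_indicator hmeas, ← integral_rescale φ hh c,
    ← integral_rescale ({u : Eucl d | R < ‖u‖}.indicator φ) hh c, ← integral_const_mul,
    ← integral_const_mul, ← integral_sub ((integrable_rescale hφ hh c).const_mul _)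
      ((integrable_rescale hi hh c).const_mul _)]
  refine integral_mono
    (((integrable_rescale hφ hh c).const_mul _).sub ((integrable_rescale hi hh c).const_mul _))
    (integrable_rescale_mul hφ hh hf hf0 hfM) fun y => ?_
  have hw : 0 ≤ (h ^ d)⁻¹ * φ (h⁻¹ • (c - y)) := mul_nonneg (by positivity) (hφ0 _)
  dsimp only
  by_cases hy : R < ‖h⁻¹ • (c - y)‖
  · rw [Set.indicator_of_mem (s := {u : Eucl d | R < ‖u‖}) hy]
    nlinarith [hf0 y]
  · rw [Set.indicator_of_notMem (s := {u : Eucl d | R < ‖u‖}) hy]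
    nlinarith [hfa y (norm_sub_le_of_rescale hh hy)]

end Bias

/-! ### Uniform consistency of the kernel density estimator -/

/-- The profile of a radial kernel, extended to a bounded antitone function on the whole line. -/
lemma IsRadialKernel.exists_profile {d : ℕ} {K : Eucl d → ℝ} (hK : IsRadialKernel K) :
    ∃ (κ : ℝ → ℝ) (B : ℝ), Antitone κ ∧ (∀ t, 0 ≤ κ t) ∧ (∀ t, κ t ≤ B) ∧ 0 < B ∧
      (∀ u, K u = κ ‖u‖) ∧ Integrable (fun u : Eucl d => κ ‖u‖) ∧
      ∫ u : Eucl d, κ ‖u‖ = 1 := by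
  obtain ⟨k, hk0, hk, hKk, hK1, -⟩ := hK
  have hmem : ∀ t : ℝ, max t 0 ∈ Set.Ici (0 : ℝ) := fun t => Set.mem_Ici.2 (le_max_right _ _)
  have hKκ : ∀ u, K u = k (max ‖u‖ 0) := fun u => by rw [hKk, max_eq_left (norm_nonneg _)]
  have h1 : ∫ u : Eucl d, k (max ‖u‖ 0) = 1 := by simpa only [hKκ] using hK1
  refine ⟨fun t => k (max t 0), k 0 + 1, fun s t hst => hk (hmem s) (hmem t)
    (max_le_max_right 0 hst), fun t => hk0 _ (hmem t), fun t => ?_, by linarith [hk0 0 le_rfl],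
    hKκ, ?_, h1⟩
  · linarith [hk (Set.self_mem_Ici (a := (0 : ℝ))) (hmem t) (hmem t)]
  · by_contra hni
    rw [integral_undef hni] at h1
    exact zero_ne_one h1

/-- The kernel density estimator at `c` with the profile `κ` shifted by `s`. For `s = ∓τ` it bounds
the estimator with profile `κ` from above and below in the whole ball `B(c, τ h)`. -/
noncomputable def shiftedKDE {d n : ℕ} (κ : ℝ → ℝ) (s h : ℝ) (x : Fin n → Eucl d) (c : Eucl d) :
    ℝ :=
  1 / n * ∑ i, (h ^ d)⁻¹ * κ (‖h⁻¹ • (c - x i)‖ + s)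

lemma bddAbove_kde {d n : ℕ} {K : Eucl d → ℝ} (hK : IsRadialKernel K) {h : ℝ} (hh : 0 < h)
    (x : Fin n → Eucl d) (s : Set (Eucl d)) : BddAbove (kde K h x '' s) := by
  obtain ⟨κ, B, -, -, hB, -, hKκ, -, -⟩ := hK.exists_profile
  refine ⟨1 / (n * h ^ d) * ∑ _i : Fin n, B, ?_⟩
  rintro _ ⟨q, -, rfl⟩
  unfold kde
  gcongr with i
  rw [hKκ]
  exact hB _

lemma kde_nonneg {d n : ℕ} {K : Eucl d → ℝ} (hK : IsRadialKernel K) {h : ℝ} (hh : 0 < h)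
    (x : Fin n → Eucl d) (q : Eucl d) : 0 ≤ kde K h x q := by
  obtain ⟨κ, B, -, h0, -, -, hKκ, -, -⟩ := hK.exists_profile
  refine mul_nonneg (by positivity) (Finset.sum_nonneg fun i _ => ?_)
  rw [hKκ]
  exact h0 _

section Bracket

variable {d n : ℕ} {K : Eucl d → ℝ} {κ : ℝ → ℝ} {h τ : ℝ} {q c : Eucl d}

lemma kde_eq_shiftedKDE (hKκ : ∀ u, K u = κ ‖u‖) (x : Fin n → Eucl d) :
    kde K h x q = shiftedKDE κ 0 h x q := by
  simp only [kde, shiftedKDE, hKκ, add_zero]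
  rw [← Finset.mul_sum, ← mul_assoc, one_div, one_div, mul_inv]

lemma norm_rescale_sub_le (hh : 0 < h) (hqc : ‖q - c‖ ≤ τ * h) (y : Eucl d) :
    |‖h⁻¹ • (q - y)‖ - ‖h⁻¹ • (c - y)‖| ≤ τ := by
  refine (abs_norm_sub_norm_le _ _).trans ?_
  rw [← smul_sub, sub_sub_sub_cancel_right, norm_smul, Real.norm_of_nonneg (by positivity),
    ← div_eq_inv_mul, div_le_iff₀ hh]
  exact hqc

lemma kde_le_shiftedKDE (hKκ : ∀ u, K u = κ ‖u‖) (hκ : Antitone κ) (hh : 0 < h)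
    (hqc : ‖q - c‖ ≤ τ * h) (x : Fin n → Eucl d) :
    kde K h x q ≤ shiftedKDE κ (-τ) h x c := by
  rw [kde_eq_shiftedKDE hKκ]
  unfold shiftedKDE
  gcongr with i
  refine hκ ?_
  linarith [(abs_le.1 (norm_rescale_sub_le hh hqc (x i))).1]

lemma shiftedKDE_le_kde (hKκ : ∀ u, K u = κ ‖u‖) (hκ : Antitone κ) (hh : 0 < h)
    (hqc : ‖q - c‖ ≤ τ * h) (x : Fin n → Eucl d) :
    shiftedKDE κ τ h x c ≤ kde K h x q := by
  rw [kde_eq_shiftedKDE hKκ]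
  unfold shiftedKDE
  gcongr with i
  refine hκ ?_
  linarith [(abs_le.1 (norm_rescale_sub_le hh hqc (x i))).2]

end Bracket

lemma integral_comp_eq_of_density {d : ℕ} {Ω : Type u} [MeasurableSpace Ω] {P : Measure Ω}
    {X : Ω → Eucl d} (hX : Measurable X) {f : Eucl d → ℝ} (hf : Measurable f)
    (hf0 : ∀ x, 0 ≤ f x)
    (hlaw : P.map X = volume.withDensity fun x => ENNReal.ofReal (f x))
    {g : Eucl d → ℝ} (hg : Measurable g) : ∫ ω, g (X ω) ∂P = ∫ y, g y * f y := by
  rw [← integral_map hX.aemeasurable hg.aestronglyMeasurable, hlaw,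
    integral_withDensity_eq_integral_toReal_smul hf.ennreal_ofReal
      (ae_of_all _ fun _ => ENNReal.ofReal_lt_top)]
  refine integral_congr_ae (ae_of_all _ fun y => ?_)
  simp only [smul_eq_mul]
  rw [ENNReal.toReal_ofReal (hf0 y), mul_comm]

/-- The summands of `shiftedKDE` are bounded by `B / h ^ d` and have mean at most `2 M`, so that the
exponent of the Chernoff bound is of order `n h ^ d`. -/
lemma measureReal_shiftedKDE_deviation_le {d n : ℕ} {Ω : Type u} [MeasurableSpace Ω]
    {P : Measure Ω} [IsProbabilityMeasure P] (hn : 0 < n) {X : Fin n → Ω → Eucl d}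
    (hX : ∀ i, Measurable (X i)) (hind : iIndepFun X P) {f : Eucl d → ℝ} (hf : Measurable f)
    (hf0 : ∀ x, 0 ≤ f x) {M : ℝ} (hM : 0 ≤ M) (hfM : ∀ x, f x ≤ M)
    (hlaw : ∀ i, P.map (X i) = volume.withDensity fun x => ENNReal.ofReal (f x))
    {κ : ℝ → ℝ} {B : ℝ} (hκ : Antitone κ) (h0 : ∀ t, 0 ≤ κ t) (hB : ∀ t, κ t ≤ B) (hB0 : 0 < B)
    {h s : ℝ} (hh : 0 < h) (hint : Integrable fun u : Eucl d => κ (‖u‖ + s))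
    (hI : ∫ u : Eucl d, κ (‖u‖ + s) ≤ 2) {η θ : ℝ} (hθ : 0 ≤ θ) (hθ1 : θ ≤ 1)
    (hθM : θ * (2 * M) ≤ η / 2) (c : Eucl d) :
    P.real {ω | (∫ y, (h ^ d)⁻¹ * κ (‖h⁻¹ • (c - y)‖ + s) * f y) + η ≤
        shiftedKDE κ s h (fun i => X i ω) c} ≤ Real.exp (-(n * h ^ d * (θ * η / (2 * B)))) ∧
    P.real {ω | shiftedKDE κ s h (fun i => X i ω) c ≤
        (∫ y, (h ^ d)⁻¹ * κ (‖h⁻¹ • (c - y)‖ + s) * f y) - η} ≤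
          Real.exp (-(n * h ^ d * (θ * η / (2 * B)))) := by
  have hg : Measurable fun y : Eucl d => (h ^ d)⁻¹ * κ (‖h⁻¹ • (c - y)‖ + s) :=
    (hκ.measurable.comp (by fun_prop)).const_mul _
  have hmean : ∫ y, (h ^ d)⁻¹ * κ (‖h⁻¹ • (c - y)‖ + s) * f y ≤ 2 * M := by
    calc _ ≤ ∫ y, (h ^ d)⁻¹ * κ (‖h⁻¹ • (c - y)‖ + s) * M := by
          refine integral_mono (integrable_rescale_mul hint hh hf hf0 hfM)
            ((integrable_rescale hint hh c).mul_const M) fun y => ?_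
          exact mul_le_mul_of_nonneg_left (hfM y) (mul_nonneg (by positivity) (h0 _))
      _ ≤ 2 * M := by
          rw [integral_mul_const, integral_rescale (fun u : Eucl d => κ (‖u‖ + s)) hh c]
          gcongr
  have hdev := measureReal_average_deviation_le (P := P) hn
    (Y := fun i ω => (h ^ d)⁻¹ * κ (‖h⁻¹ • (c - X i ω)‖ + s)) (fun i => hg.comp (hX i))
    (hind.comp (fun _ y => (h ^ d)⁻¹ * κ (‖h⁻¹ • (c - y)‖ + s)) fun _ => hg)
    (b := (h ^ d)⁻¹ * B) (by positivity) (fun i ω => mul_nonneg (by positivity) (h0 _))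
    (fun i ω => mul_le_mul_of_nonneg_left (hB _) (by positivity))
    (fun i => integral_comp_eq_of_density (hX i) hf hf0 (hlaw i) hg) hmean hθ hθ1 hθM
  have hexp : (n : ℝ) * θ * η / (2 * ((h ^ d)⁻¹ * B)) = n * h ^ d * (θ * η / (2 * B)) := by
    field_simp
  rw [hexp] at hdev
  exact hdev

lemma ae_mem_of_density {d : ℕ} {Ω : Type u} [MeasurableSpace Ω] {P : Measure Ω}
    {X : Ω → Eucl d} (hX : Measurable X) {f : Eucl d → ℝ} {𝒳 : Set (Eucl d)}
    (hf : IsDensityOn f 𝒳)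
    (hlaw : P.map X = volume.withDensity fun x => ENNReal.ofReal (f x)) :
    ∀ᵐ ω ∂P, X ω ∈ 𝒳 := by
  refine ae_of_ae_map hX.aemeasurable (p := fun x => x ∈ 𝒳) ?_
  rw [hlaw, ae_withDensity_iff hf.measurable.ennreal_ofReal]
  refine ae_of_all _ fun x hx => ?_
  by_contra hx𝒳
  exact hx (by rw [hf.eq_zero_off x hx𝒳, ENNReal.ofReal_zero])

lemma IsDensityOn.exists_bound {d : ℕ} {f : Eucl d → ℝ} {𝒳 : Set (Eucl d)}
    (hf : IsDensityOn f 𝒳) (h𝒳 : IsCompact 𝒳) (hcont : ContinuousOn f 𝒳) :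
    ∃ M, 1 ≤ M ∧ ∀ x, f x ≤ M := by
  obtain ⟨M, hM⟩ := h𝒳.exists_bound_of_continuousOn hcont
  refine ⟨max 1 M, le_max_left _ _, fun x => ?_⟩
  by_cases hx : x ∈ 𝒳
  · exact (le_abs_self _).trans ((hM x hx).trans (le_max_right _ _))
  · rw [hf.eq_zero_off x hx]
    exact zero_le_one.trans (le_max_left _ _)

/-- The bias of the bracketing estimators at a point `c` of the support. At the boundary of the
support the estimator is biased downwards, hence the extra hypothesis of the lower bound. -/
lemma bias_bounds {d : ℕ} {f : Eucl d → ℝ} {𝒳 : Set (Eucl d)} (hf : IsDensityOn f 𝒳)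
    {M : ℝ} (hfM : ∀ x, f x ≤ M) {η ρ : ℝ} (hη : 0 < η)
    (hmod : ∀ x ∈ 𝒳, ∀ y ∈ 𝒳, dist x y < ρ → dist (f x) (f y) < η)
    {κ : ℝ → ℝ} (hκ : Antitone κ) (h0 : ∀ t, 0 ≤ κ t)
    {h s R e : ℝ} (hh : 0 < h) (hs : -1 ≤ s)
    (hint1 : Integrable fun u : Eucl d => κ (‖u‖ + -1))
    (hint : Integrable fun u : Eucl d => κ (‖u‖ + s))
    (hI : |(∫ u : Eucl d, κ (‖u‖ + s)) - 1| ≤ e) (he1 : e ≤ 1) (heM : M * e ≤ η)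
    (hT : ∫ u in {u : Eucl d | R < ‖u‖}, κ (‖u‖ + -1) ≤ e) (hRh : R * h < ρ)
    {c : Eucl d} (hc : c ∈ 𝒳) :
    ∫ y, (h ^ d)⁻¹ * κ (‖h⁻¹ • (c - y)‖ + s) * f y ≤ f c + 4 * η ∧
    (Metric.closedBall c (R * h) ⊆ 𝒳 →
      f c - 3 * η ≤ ∫ y, (h ^ d)⁻¹ * κ (‖h⁻¹ • (c - y)‖ + s) * f y) := by
  have hT0 : 0 ≤ ∫ u in {u : Eucl d | R < ‖u‖}, κ (‖u‖ + -1) :=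
    integral_nonneg fun u => h0 _
  have he0 : 0 ≤ e := hT0.trans hT
  have hTs : ∫ u in {u : Eucl d | R < ‖u‖}, κ (‖u‖ + s) ≤ e :=
    (integral_mono hint.integrableOn hint1.integrableOn fun u => hκ (by linarith)).trans hT
  have hM : 0 ≤ M := (hf.nonneg c).trans (hfM c)
  obtain ⟨hI1, hI2⟩ := abs_le.1 hI
  constructor
  · have hfa : ∀ y, ‖y - c‖ ≤ R * h → f y ≤ f c + η := fun y hy => by
      by_cases hy𝒳 : y ∈ 𝒳
      · have := hmod y hy𝒳 c hc (by rw [dist_eq_norm]; linarith)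
        rw [Real.dist_eq] at this
        linarith [le_abs_self (f y - f c)]
      · rw [hf.eq_zero_off y hy𝒳]
        linarith [hf.nonneg c]
    refine (integral_rescale_mul_le hint (fun u => h0 _) hh hf.measurable hf.nonneg hfM
      (by linarith [hf.nonneg c]) hfa).trans ?_
    have h1 : (f c + η) * ∫ u : Eucl d, κ (‖u‖ + s) ≤ (f c + η) * (1 + e) :=
      mul_le_mul_of_nonneg_left (by linarith) (by linarith [hf.nonneg c])
    have h2 : M * ∫ u in {u : Eucl d | R < ‖u‖}, κ (‖u‖ + s) ≤ M * e :=
      mul_le_mul_of_nonneg_left hTs hM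
    have h3 : f c * e ≤ M * e := mul_le_mul_of_nonneg_right (hfM c) he0
    have h4 : η * e ≤ η := mul_le_of_le_one_right hη.le he1
    linarith
  · intro hsub
    have hfa : ∀ y, ‖y - c‖ ≤ R * h → max (f c - η) 0 ≤ f y := fun y hy => by
      refine max_le ?_ (hf.nonneg y)
      have hy𝒳 : y ∈ 𝒳 := hsub (by rwa [Metric.mem_closedBall, dist_eq_norm])
      have := hmod c hc y hy𝒳 (by rw [dist_comm, dist_eq_norm]; linarith)
      rw [Real.dist_eq] at this
      linarith [le_abs_self (f c - f y)]
    refine le_trans ?_ (le_integral_rescale_mul hint (fun u => h0 _) hh hf.measurable hf.nonneg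
      hfM hfa)
    have hL : max (f c - η) 0 ≤ M := max_le (by linarith [hfM c]) hM
    have hL0 : 0 ≤ max (f c - η) 0 := le_max_right _ _
    have hL1 : f c - η ≤ max (f c - η) 0 := le_max_left _ _
    generalize max (f c - η) 0 = L at *
    have h1 : L * (1 - e) ≤ L * ∫ u : Eucl d, κ (‖u‖ + s) :=
      mul_le_mul_of_nonneg_left (by linarith) hL0
    have h2 : L * ∫ u in {u : Eucl d | R < ‖u‖}, κ (‖u‖ + s) ≤ L * e :=
      mul_le_mul_of_nonneg_left hTs hL0
    have h3 : L * e ≤ M * e := mul_le_mul_of_nonneg_right hL he0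
    linarith

/-- Uniform one-sided consistency: for large `n`, with probability at least `1 - 1 / n`, the kernel
density estimator exceeds the density nowhere on its support by more than `η`, and falls short of
it by at most `η` at all points of distance at least `ρ₀` to the complement of the support. -/
theorem kde_uniform_consistency {d : ℕ} (hd : d ≠ 0) {𝒳 : Set (Eucl d)} (h𝒳 : IsCompact 𝒳)
    {f : Eucl d → ℝ} (hf : IsDensityOn f 𝒳) (hcont : ContinuousOn f 𝒳)
    {K : Eucl d → ℝ} (hK : IsRadialKernel K)
    {h : ℕ → ℝ} (hpos : ∀ n, 0 < h n) (hlim : Tendsto h atTop (𝓝 0))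
    (hlim' : Tendsto (fun n : ℕ => Real.log n / (n * h n ^ d)) atTop (𝓝 0))
    {η ρ₀ : ℝ} (hη : 0 < η) (hρ₀ : 0 < ρ₀) :
    ∃ N : ℕ, ∀ n : ℕ, N ≤ n →
      ∀ (Ω : Type u) [MeasurableSpace Ω] (P : Measure Ω) [IsProbabilityMeasure P]
        (X : Fin n → Ω → Eucl d), (∀ i, Measurable (X i)) → iIndepFun X P →
        (∀ i, P.map (X i) = volume.withDensity fun x => ENNReal.ofReal (f x)) →
        HoldsWithProb P (1 - 1 / n) fun ω => ∀ x ∈ 𝒳,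
          kde K (h n) (fun i => X i ω) x ≤ f x + η ∧
          (Metric.ball x ρ₀ ⊆ 𝒳 → f x - η ≤ kde K (h n) (fun i => X i ω) x) := by
  obtain ⟨κ, B, hκ, h0, hB, hB0, hKκ, hint0, hint1⟩ := hK.exists_profile
  obtain ⟨M, hM1, hfM⟩ := hf.exists_bound h𝒳 hcont
  have hM0 : 0 < M := by linarith
  obtain ⟨R𝒳, hR𝒳⟩ := h𝒳.isBounded.subset_closedBall 0
  have hR𝒳' : 𝒳 ⊆ Metric.closedBall 0 (max R𝒳 0) :=
    hR𝒳.trans (Metric.closedBall_subset_closedBall (le_max_left _ _))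
  -- The total error `η` is made up of four parts of bias at a net point, one part for passing to
  -- the net point and one part of random deviation.
  set η₀ := η / 6 with hη₀_def
  have hη₀ : 0 < η₀ := by positivity
  obtain ⟨ρ, hρ, hmod⟩ := Metric.uniformContinuousOn_iff.1
    (h𝒳.uniformContinuousOn_of_continuous hcont) η₀ hη₀
  set e := min 1 (η₀ / M) with he_def
  have he : 0 < e := lt_min one_pos (by positivity)
  have he1 : e ≤ 1 := min_le_left _ _
  have heM : M * e ≤ η₀ := by
    calc M * e ≤ M * (η₀ / M) := by gcongr; exact min_le_right _ _
      _ = η₀ := by field_simp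
  obtain ⟨τ, hτ, hτ1, hIτ⟩ : ∃ τ : ℝ, 0 < τ ∧ τ ≤ 1 ∧
      ∀ s : ℝ, |s| ≤ τ → |(∫ u : Eucl d, κ (‖u‖ + s)) - 1| ≤ e := by
    have ht := tendsto_integral_shift hd hκ h0 hB hint0
    rw [hint1] at ht
    obtain ⟨τ, hτ, H⟩ := Metric.tendsto_nhds_nhds.1 ht e he
    refine ⟨min (τ / 2) 1, by positivity, min_le_right _ _, fun s hs => ?_⟩
    have hs' : |s| < τ := hs.trans_lt ((min_le_left _ _).trans_lt (half_lt_self hτ))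
    have := H (x := s) (by rwa [Real.dist_eq, sub_zero])
    rw [Real.dist_eq] at this
    exact this.le
  have hints : ∀ s : ℝ, -1 ≤ s → Integrable fun u : Eucl d => κ (‖u‖ + s) := fun s hs =>
    integrable_shift hκ h0 hB hint0 hs
  have hI2 : ∀ s : ℝ, |s| ≤ τ → ∫ u : Eucl d, κ (‖u‖ + s) ≤ 2 := fun s hs => by
    linarith [(abs_le.1 (hIτ s hs)).2]
  obtain ⟨R, hR0, hR⟩ : ∃ R : ℝ, 0 < R ∧
      ∫ u in {u : Eucl d | R < ‖u‖}, κ (‖u‖ + -1) ≤ e :=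
    ((eventually_gt_atTop 0).and
      ((tendsto_setIntegral_norm_gt (hints (-1) le_rfl)).eventually_le_const he)).exists
  set θ := min 1 (η₀ / (4 * M)) with hθ_def
  have hθ : 0 < θ := lt_min one_pos (by positivity)
  have hθM : θ * (2 * M) ≤ η₀ / 2 := by
    calc θ * (2 * M) ≤ η₀ / (4 * M) * (2 * M) := by gcongr; exact min_le_right _ _
      _ = η₀ / 2 := by field_simp; norm_num
  set A := (2 * max R𝒳 0 + 2) ^ d / τ ^ d with hA_def
  have hev : ∀ᶠ n : ℕ in atTop, 3 ≤ n ∧ 2 * A ≤ n ∧ h n < 1 ∧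
      (R + τ) * h n < min ρ ρ₀ ∧ Real.log n / (n * h n ^ d) ≤ 1 ∧
      Real.log n / (n * h n ^ d) ≤ θ * η₀ / (2 * B) / 3 := by
    have hRh : Tendsto (fun n => (R + τ) * h n) atTop (𝓝 0) := by
      simpa using hlim.const_mul (R + τ)
    exact (eventually_ge_atTop 3).and <|
      (tendsto_natCast_atTop_atTop.eventually_ge_atTop (2 * A)).and <|
      (hlim.eventually_lt_const one_pos).and <|
      (hRh.eventually_lt_const (lt_min hρ hρ₀)).and <|
      (hlim'.eventually_le_const one_pos).and <|
      hlim'.eventually_le_const (by positivity)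
  obtain ⟨N, hN⟩ := eventually_atTop.1 hev
  refine ⟨N, fun n hn Ω _ P _ X hX hind hlaw => ?_⟩
  obtain ⟨hn3, hnA, hh1, hRh, hlog1, hlogq⟩ := hN n hn
  have hh := hpos n
  have hn0 : (0 : ℝ) < n := by exact_mod_cast (by omega : 0 < n)
  have hnh : 0 < (n : ℝ) * h n ^ d := by positivity
  obtain ⟨t, ht𝒳, htnet, htcard⟩ := exists_net (le_max_right R𝒳 0) (mul_pos hτ hh)
    (mul_le_one₀ hτ1 hh.le hh1.le) hR𝒳'
  -- Since `n h ^ d ≥ log n ≥ 1`, the net has at most `A n` points.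
  have hcard : (t.card : ℝ) ≤ A * n := by
    have hlogn : 1 ≤ Real.log n := by
      rw [Real.le_log_iff_exp_le hn0]
      have : (3 : ℝ) ≤ n := by exact_mod_cast hn3
      linarith [Real.exp_one_lt_d9]
    rw [div_le_one hnh] at hlog1
    rw [mul_pow, ← mul_assoc, ← le_div_iff₀ (by positivity)] at htcard
    have h1 : t.card * τ ^ d ≤ (2 * max R𝒳 0 + 2) ^ d * n := by
      refine htcard.trans ?_
      rw [div_le_iff₀ (by positivity), mul_assoc]
      exact le_mul_of_one_le_right (by positivity) (hlogn.trans hlog1)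
    rw [hA_def, div_mul_eq_mul_div, le_div_iff₀ (by positivity)]
    exact h1
  have hexp : Real.exp (-(n * h n ^ d * (θ * η₀ / (2 * B)))) ≤ ((n : ℝ) ^ 3)⁻¹ := by
    rw [div_le_iff₀ hnh] at hlogq
    have h1 : (n : ℝ) ^ 3 = Real.exp (3 * Real.log n) := by
      rw [mul_comm, Real.exp_mul, Real.exp_log hn0]
      norm_cast
    rw [h1, ← Real.exp_neg, Real.exp_le_exp]
    linarith
  have hdev := fun (s : ℝ) (hs : |s| ≤ τ) (c : Eucl d) =>
    measureReal_shiftedKDE_deviation_le (P := P) (by omega) hX hind hf.measurable hf.nonneg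
      hM0.le hfM hlaw hκ h0 hB hB0 hh (hints s (by linarith [(abs_le.1 hs).1])) (hI2 s hs)
      hθ.le (min_le_left _ _) hθM c
  have hτabs : |τ| ≤ τ := (abs_of_pos hτ).le
  have hτabs' : |(-τ)| ≤ τ := by rwa [abs_neg]
  let mean : ℝ → Eucl d → ℝ := fun s c =>
    ∫ y, (h n ^ d)⁻¹ * κ (‖(h n)⁻¹ • (c - y)‖ + s) * f y
  let bad : Eucl d → Set Ω := fun c =>
    {ω | mean (-τ) c + η₀ ≤ shiftedKDE κ (-τ) (h n) (fun i => X i ω) c} ∪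
    {ω | shiftedKDE κ τ (h n) (fun i => X i ω) c ≤ mean τ c - η₀}
  have hmeasS : ∀ s c, Measurable fun ω => shiftedKDE κ s (h n) (fun i => X i ω) c := fun s c => by
    unfold shiftedKDE
    exact (Finset.measurable_sum _ fun i _ => ((hκ.measurable.comp
      (by fun_prop : Measurable fun ω => ‖(h n)⁻¹ • (c - X i ω)‖ + s)).const_mul _)).const_mul _
  have hbad : MeasurableSet (⋃ c ∈ t, bad c) := Finset.measurableSet_biUnion _ fun c _ =>
    (measurableSet_le measurable_const (hmeasS _ _)).union
      (measurableSet_le (hmeasS _ _) measurable_const)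
  have hPbad : P.real (⋃ c ∈ t, bad c) ≤ 1 / n := by
    calc P.real (⋃ c ∈ t, bad c) ≤ ∑ c ∈ t, P.real (bad c) := measureReal_biUnion_finset_le _ _
      _ ≤ ∑ _c ∈ t, 2 * ((n : ℝ) ^ 3)⁻¹ := by
          refine Finset.sum_le_sum fun c _ => (measureReal_union_le _ _).trans ?_
          rw [two_mul]
          exact add_le_add ((hdev _ hτabs' c).1.trans hexp) ((hdev _ hτabs c).2.trans hexp)
      _ = t.card * (2 * ((n : ℝ) ^ 3)⁻¹) := by rw [Finset.sum_const, nsmul_eq_mul]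
      _ ≤ A * n * (2 * ((n : ℝ) ^ 3)⁻¹) := by gcongr
      _ = 2 * A / n * (1 / n) := by field_simp
      _ ≤ 1 * (1 / n) := by
          gcongr
          rwa [div_le_one hn0]
      _ = 1 / n := one_mul _
  refine ⟨(⋃ c ∈ t, bad c)ᶜ, hbad.compl, ?_, fun ω hω x hx => ?_⟩
  · rw [← ofReal_measureReal]
    refine ENNReal.ofReal_le_ofReal ?_
    rw [probReal_compl_eq_one_sub hbad]
    linarith
  obtain ⟨c, hct, hxc⟩ := htnet x hx
  have hc𝒳 : c ∈ 𝒳 := ht𝒳 hct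
  have hgood : ω ∉ bad c := fun hb => hω (Set.mem_biUnion (x := c) hct hb)
  have hg1 : shiftedKDE κ (-τ) (h n) (fun i => X i ω) c < mean (-τ) c + η₀ :=
    not_le.1 fun hle => hgood (Or.inl hle)
  have hg2 : mean τ c - η₀ < shiftedKDE κ τ (h n) (fun i => X i ω) c :=
    not_le.1 fun hle => hgood (Or.inr hle)
  have hRh0 : 0 < R * h n := by positivity
  have hτh0 : 0 < τ * h n := by positivity
  have hRρ : R * h n + τ * h n < ρ := by
    rw [← add_mul]; exact hRh.trans_le (min_le_left _ _)
  have hRρ₀ : R * h n + τ * h n < ρ₀ := by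
    rw [← add_mul]; exact hRh.trans_le (min_le_right _ _)
  have hfxc := hmod x hx c hc𝒳 (by linarith)
  rw [Real.dist_eq, abs_lt] at hfxc
  have hbias := fun (s : ℝ) (hs : |s| ≤ τ) => bias_bounds hf hfM hη₀ hmod hκ h0 hh
    (s := s) (by linarith [(abs_le.1 hs).1]) (hints (-1) le_rfl)
    (hints s (by linarith [(abs_le.1 hs).1])) (hIτ s hs) he1 heM hR (by linarith) hc𝒳
  rw [dist_eq_norm] at hxc
  constructor
  · have h1 := kde_le_shiftedKDE hKκ hκ hh hxc fun i => X i ω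
    have h2 : mean (-τ) c ≤ f c + 4 * η₀ := (hbias _ hτabs').1
    linarith
  · intro hball
    have h1 := shiftedKDE_le_kde hKκ hκ hh hxc fun i => X i ω
    have h2 : f c - 3 * η₀ ≤ mean τ c := (hbias _ hτabs).2 fun y hy => hball (by
      rw [Metric.mem_closedBall] at hy
      rw [Metric.mem_ball]
      have := dist_triangle_right y x c
      rw [dist_eq_norm x c] at this
      linarith)
    linarith

/-! ### Events of high probability -/

/-- A union bound for two events of probability at least `1 - p` and `1 - q`. -/
lemma HoldsWithProb.and {Ω : Type u} [MeasurableSpace Ω] {P : Measure Ω} [IsProbabilityMeasure P]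
    {p q : ℝ} {Q₁ Q₂ : Ω → Prop} (h₁ : HoldsWithProb P (1 - p) Q₁)
    (h₂ : HoldsWithProb P (1 - q) Q₂) :
    HoldsWithProb P (1 - (p + q)) fun ω => Q₁ ω ∧ Q₂ ω := by
  obtain ⟨A₁, hA₁, hP₁, hQ₁⟩ := h₁
  obtain ⟨A₂, hA₂, hP₂, hQ₂⟩ := h₂
  refine ⟨A₁ ∩ A₂, hA₁.inter hA₂, ?_, fun ω hω => ⟨hQ₁ ω hω.1, hQ₂ ω hω.2⟩⟩
  rw [ENNReal.ofReal_le_iff_le_toReal (measure_ne_top _ _)] at hP₁ hP₂ ⊢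
  have h1 : P.real (A₁ ∩ A₂)ᶜ ≤ P.real A₁ᶜ + P.real A₂ᶜ := by
    rw [Set.compl_inter]
    exact measureReal_union_le _ _
  rw [probReal_compl_eq_one_sub hA₁, probReal_compl_eq_one_sub hA₂,
    probReal_compl_eq_one_sub (hA₁.inter hA₂)] at h1
  simp only [measureReal_def] at h1
  linarith

lemma HoldsWithProb.of_ae {Ω : Type u} [MeasurableSpace Ω] {P : Measure Ω}
    [IsProbabilityMeasure P] {Q : Ω → Prop} (h : ∀ᵐ ω ∂P, Q ω) : HoldsWithProb P (1 - 0) Q := by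
  refine ⟨(toMeasurable P {ω | ¬ Q ω})ᶜ, (measurableSet_toMeasurable _ _).compl, ?_,
    fun ω hω => not_not.1 fun hQ => hω (subset_toMeasurable _ _ hQ)⟩
  rw [prob_compl_eq_one_sub (measurableSet_toMeasurable _ _), measure_toMeasurable, ae_iff.1 h]
  simp

/-! ### Paths in a Quick Shift graph -/

section Graph

variable {d n : ℕ} {x : Fin n → Eucl d} {g : Eucl d → ℝ} {k : ℕ} {c r : ℝ}
  {G : Digraph (Fin n)}

lemma IsQuickShiftGraph.adj (hG : IsQuickShiftGraph x g k c r G) {i j : Fin n}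
    (hij : G.Adj i j) : dist (x i) (x j) ≤ c * r ∧ g (x i) < g (x j) := by
  obtain ⟨nbr, top, hans, htop, hadj⟩ := hG
  obtain ⟨hne, rfl, hlt⟩ := (hadj i j).1 hij
  exact ⟨(hans i).1 _ (htop i hne).1, hlt⟩

lemma IsQuickShiftGraph.le_of_reachable (hG : IsQuickShiftGraph x g k c r G) {i j : Fin n}
    (hij : Relation.ReflTransGen G.Adj i j) : g (x i) ≤ g (x j) := by
  induction hij with
  | refl => exact le_rfl
  | tail _ hab ih => exact ih.trans (hG.adj hab).2.le

/-- A directed path of the graph is followed by straight segments. -/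
lemma IsQuickShiftGraph.joinedIn (hG : IsQuickShiftGraph x g k c r G) {𝒳 S : Set (Eucl d)}
    (hx : ∀ i, x i ∈ 𝒳) {rs : ℝ} (hrs : 0 < rs) (hcr : c * r < rs) {i j : Fin n}
    (hij : Relation.ReflTransGen G.Adj i j)
    (hS : ∀ a, Relation.ReflTransGen G.Adj i a → ∀ p ∈ S, rs ≤ dist p (x a)) :
    JoinedIn (convexHull ℝ 𝒳 \ S) (x i) (x j) := by
  induction hij with
  | refl =>
    exact JoinedIn.refl ⟨subset_convexHull ℝ 𝒳 (hx i), fun hi => by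
      have := hS i .refl _ hi
      rw [dist_self] at this
      linarith⟩
  | @tail a b hia hab ih =>
    refine ih.trans (JoinedIn.of_segment_subset fun p hp => ⟨?_, fun hpS => ?_⟩)
    · exact (convex_convexHull ℝ 𝒳).segment_subset (subset_convexHull ℝ 𝒳 (hx a))
        (subset_convexHull ℝ 𝒳 (hx b)) hp
    · have h1 := hS a hia p hpS
      have h2 := dist_add_dist_of_mem_segment hp
      rw [dist_comm (x a) p] at h2
      linarith [(hG.adj hab).1, dist_nonneg (x := p) (y := x b)]

end Graph

/-! ### Separated points -/

section Separated

variable {d : ℕ} {f : Eucl d → ℝ} {𝒳 S : Set (Eucl d)} {r δ : ℝ}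

lemma not_isSeparated_of_dim_eq_zero (hd : d = 0) (hr : 0 < r) (hδ : 0 < δ) (hf0 : ∀ x, 0 ≤ f x)
    (x₁ x₂ : Eucl d) : ¬ IsSeparated f 𝒳 r δ x₁ x₂ := by
  subst hd
  rintro ⟨h1, -, S, -, hpath, hlt⟩
  obtain rfl := Subsingleton.elim x₁ x₂
  obtain ⟨t, ht⟩ := hpath (Path.refl x₁) fun _ => subset_convexHull ℝ 𝒳 h1
  have hfin : ∀ s : Set (Eucl 0), BddAbove (f '' s) := fun s => (s.toFinite.image f).bddAbove
  have h2 : f x₁ ≤ sSup (f '' (S + Metric.ball 0 r)) :=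
    le_csSup (hfin _) ⟨x₁, ⟨_, ht, 0, Metric.mem_ball_self hr, Subsingleton.elim _ _⟩, rfl⟩
  have h3 : sInf (f '' (Metric.ball x₁ r ∪ Metric.ball x₁ r)) ≤ f x₁ :=
    csInf_le ⟨0, by rintro _ ⟨y, -, rfl⟩; exact hf0 y⟩ ⟨x₁, Or.inl (Metric.mem_ball_self hr), rfl⟩
  linarith

/-- The numerical content of separation: one level `v ≥ 0` bounds `f` within distance `r` of the
barrier, and `f` exceeds `v + δ` near the two points. -/
lemma IsSeparated.exists_level {M : ℝ} (hf0 : ∀ x, 0 ≤ f x) (hfM : ∀ x, f x ≤ M)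
    {x₁ x₂ : Eucl d} (h : IsSeparated f 𝒳 r δ x₁ x₂) :
    ∃ (S : Set (Eucl d)) (v : ℝ), ¬ JoinedIn (convexHull ℝ 𝒳 \ S) x₁ x₂ ∧ 0 ≤ v ∧
      (∀ p ∈ S, ∀ y, dist p y < r → f y ≤ v) ∧
      (∀ y, dist y x₁ < r ∨ dist y x₂ < r → v + δ < f y) := by
  obtain ⟨-, -, S, -, hpath, hlt⟩ := h
  refine ⟨S, sSup (f '' (S + Metric.ball 0 r)), ?_, ?_, fun p hp y hpy => ?_, fun y hy => ?_⟩
  · rintro ⟨γ, hγ⟩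
    obtain ⟨t, ht⟩ := hpath γ fun t => (hγ t).1
    exact (hγ t).2 ht
  · refine Real.sSup_nonneg ?_
    rintro _ ⟨y, -, rfl⟩
    exact hf0 y
  · refine le_csSup ⟨M, ?_⟩ ⟨y, ⟨p, hp, y - p, ?_, add_sub_cancel p y⟩, rfl⟩
    · rintro _ ⟨z, -, rfl⟩
      exact hfM z
    · rwa [mem_ball_zero_iff, ← dist_eq_norm, dist_comm]
  · have h1 : sInf (f '' (Metric.ball x₁ r ∪ Metric.ball x₂ r)) ≤ f y := by
      refine csInf_le ⟨0, ?_⟩ ⟨y, hy, rfl⟩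
      rintro _ ⟨z, -, rfl⟩
      exact hf0 z
    linarith

end Separated

/-! ### Separation of the trees -/

/-- The deterministic part of the argument. A directed path from `x i` to `x j` followed by the
segment from `x j` to `x₀` has to meet the barrier. The segment cannot, since `f` is large near
`x₀`. So some vertex of the path lies near the barrier, where the density estimate is small,
although the estimate does not decrease along the path. -/
lemma not_reachable_of_isSeparated {d n : ℕ} {x : Fin n → Eucl d} {f g F : Eucl d → ℝ}
    {𝒳 : Set (Eucl d)} {k : ℕ} {c r rs δ M : ℝ} {G : Digraph (Fin n)}
    (hG : IsQuickShiftGraph x g k c r G) (hx : ∀ i, x i ∈ 𝒳) (hrs : 0 < rs) (hδ : 0 < δ)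
    (hcr : c * r < rs) (hf : IsDensityOn f 𝒳) (hfM : ∀ x, f x ≤ M)
    (hF : ∀ y ∈ 𝒳, F y ≤ f y + δ / 4 ∧ (Metric.ball y rs ⊆ 𝒳 → f y - δ / 4 ≤ F y))
    (hg : ∀ y ∈ 𝒳, |g y - F y| < δ / 4)
    {x₀ : Eucl d} {i j : Fin n} (hsep : IsSeparated f 𝒳 rs δ (x i) x₀)
    (hj : ‖x j - x₀‖ < rs) : ¬ Relation.ReflTransGen G.Adj i j := by
  intro hij
  have hx₀ : x₀ ∈ 𝒳 := hsep.2.1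
  obtain ⟨S, v, hnot, hv, hlow, hhigh⟩ := hsep.exists_level hf.nonneg hfM
  -- `f` is positive on this ball, so that the ball lies in the support.
  have hball : Metric.ball (x i) rs ⊆ 𝒳 := fun y hy => by
    by_contra hy𝒳
    have := hhigh y (Or.inl hy)
    rw [hf.eq_zero_off y hy𝒳] at this
    linarith
  refine hnot ((hG.joinedIn hx hrs hcr hij fun a hia p hp => ?_).trans
    (JoinedIn.of_segment_subset fun p hp => ⟨?_, fun hpS => ?_⟩))
  · by_contra! hlt
    have h1 := hlow p hp (x a) hlt
    have h2 := hhigh (x i) (Or.inl (by rwa [dist_self]))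
    have h3 := hG.le_of_reachable hia
    have h4 := (hF _ (hx i)).2 hball
    have h5 := (hF _ (hx a)).1
    have h6 := abs_lt.1 (hg _ (hx i))
    have h7 := abs_lt.1 (hg _ (hx a))
    linarith
  · exact (convex_convexHull ℝ 𝒳).segment_subset (subset_convexHull ℝ 𝒳 (hx j))
      (subset_convexHull ℝ 𝒳 hx₀) hp
  · have h1 := dist_add_dist_of_mem_segment hp
    rw [dist_eq_norm (x j) x₀] at h1
    have h2 := hlow p hpS x₀ (by linarith [dist_nonneg (x := x j) (y := p)])
    have h3 := hhigh x₀ (Or.inr (by rwa [dist_self]))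
    linarith

theorem mainTheorem4 {d : ℕ}
    (𝒳 : Set (Eucl d)) (h𝒳 : IsCompact 𝒳)
    (f : Eucl d → ℝ) (hf : IsDensityOn f 𝒳)
    (α Cα : ℝ) (hα : 0 < α) (hα1 : α ≤ 1) (hCα : 0 < Cα)
    (hHolder : ∀ x ∈ 𝒳, ∀ y ∈ 𝒳, |f x - f y| ≤ Cα * ‖x - y‖ ^ α)
    (K : Eucl d → ℝ) (hK : IsRadialKernel K)
    (h : ℕ → ℝ) (hpos : ∀ n, 0 < h n) (hlim : Tendsto h atTop (𝓝 0))
    (hlim' : Tendsto (fun n : ℕ => Real.log n / (n * h n ^ d)) atTop (𝓝 0)) :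
    ∃ C : ℝ, 0 < C ∧ ∀ rs δ : ℝ, 0 < rs → 0 < δ → ∃ N : ℕ, ∀ n : ℕ, N ≤ n →
      ∀ (Ω : Type u) [MeasurableSpace Ω] (P : Measure Ω) [IsProbabilityMeasure P]
        (X : Fin n → Ω → Eucl d), (∀ i, Measurable (X i)) → iIndepFun X P →
        (∀ i, P.map (X i) = volume.withDensity fun x => ENNReal.ofReal (f x)) →
      ∀ (ε : ℝ) (ftilde : Ω → Eucl d → ℝ), 0 < ε → IsKDEOracle P 𝒳 K (h n) ε X ftilde →
      ∀ (k : ℕ) (c r : ℝ), 1 ≤ c → 0 < r → c * r < rs / 2 →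
      ∀ G : Ω → Digraph (Fin n),
        (∀ ω, IsQuickShiftGraph (fun i => X i ω) (ftilde ω) k c r (G ω)) →
        HoldsWithProb P (1 - 2 / n) fun ω =>
          C * ε * sSup (kde K (h n) (fun i => X i ω) '' 𝒳) < δ →
          ∀ x₀, IsMode f 𝒳 x₀ → ∀ i, IsSeparated f 𝒳 rs δ (X i ω) x₀ →
            ∀ j, ‖X j ω - x₀‖ < rs → ¬ InTreeRootedAt (G ω) i j := by
  refine ⟨4, by norm_num, fun rs δ hrs hδ => ?_⟩
  by_cases hd : d = 0
  -- In dimension `0` the oracle hypothesis is empty for large `n`, but no points are separated.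
  · refine ⟨0, fun n _ Ω _ P _ X _ _ _ ε ftilde _ _ k c r _ _ _ G _ =>
      ⟨Set.univ, MeasurableSet.univ, ?_, fun ω _ _ x₀ _ i hsep => ?_⟩⟩
    · rw [measure_univ, ← ENNReal.ofReal_one]
      exact ENNReal.ofReal_le_ofReal (sub_le_self _ (by positivity))
    · exact absurd hsep (not_isSeparated_of_dim_eq_zero hd hrs hδ hf.nonneg _ _)
  have hcont : ContinuousOn f 𝒳 := by
    intro x hx
    have hpow : Tendsto (fun y => Cα * ‖y - x‖ ^ α) (𝓝[𝒳] x) (𝓝 0) := by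
      have h1 : Continuous fun y : Eucl d => Cα * ‖y - x‖ ^ α :=
        continuous_const.mul ((by fun_prop : Continuous fun y : Eucl d => ‖y - x‖).rpow_const
          fun _ => Or.inr hα.le)
      exact (h1.tendsto' x 0 (by simp [Real.zero_rpow hα.ne'])).mono_left nhdsWithin_le_nhds
    refine tendsto_iff_norm_sub_tendsto_zero.2 (squeeze_zero' ?_ ?_ hpow)
    · exact Eventually.of_forall fun y => norm_nonneg _
    · filter_upwards [self_mem_nhdsWithin] with y hy
      exact hHolder y hy x hx
  obtain ⟨M, -, hfM⟩ := hf.exists_bound h𝒳 hcont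
  obtain ⟨N₁, hN₁⟩ := kde_uniform_consistency.{u} hd h𝒳 hf hcont hK hpos hlim hlim'
    (show 0 < δ / 4 by positivity) hrs
  obtain ⟨N₂, hN₂⟩ := eventually_atTop.1 (hlim'.eventually_le_const one_pos)
  refine ⟨max (max N₁ N₂) 1, fun n hn Ω _ P _ X hX hind hlaw ε ftilde hε horacle k c r _ _ hcr G
    hG => ?_⟩
  have hn1 : 1 ≤ n := (le_max_right _ _).trans hn
  have hn0 : (0 : ℝ) < n := by exact_mod_cast hn1
  have hh := hpos n
  have hbandwidth : (Real.log n / n) ^ ((1 : ℝ) / d) ≤ h n := by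
    have h1 := hN₂ n (((le_max_right _ _).trans (le_max_left _ _)).trans hn)
    rw [← div_div, div_le_one (by positivity)] at h1
    calc (Real.log n / n) ^ ((1 : ℝ) / d) ≤ (h n ^ d) ^ ((1 : ℝ) / d) :=
          Real.rpow_le_rpow (div_nonneg (Real.log_natCast_nonneg n) hn0.le) h1 (by positivity)
      _ = h n := by rw [one_div, Real.pow_rpow_inv_natCast hh.le hd]
  have hall := ((hN₁ n (((le_max_left _ _).trans (le_max_left _ _)).trans hn) Ω P X hX hind
    hlaw).and (horacle hbandwidth)).and (HoldsWithProb.of_ae (ae_all_iff.2 fun i =>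
      ae_mem_of_density (hX i) hf (hlaw i)))
  have hprob : (1 : ℝ) - (1 / n + 1 / n + 0) = 1 - 2 / n := by ring
  rw [hprob] at hall
  obtain ⟨A, hA, hPA, hQ⟩ := hall
  refine ⟨A, hA, hPA, fun ω hω hsmall x₀ _ i hsep j hj htree => ?_⟩
  obtain ⟨⟨hF, hor⟩, hmem⟩ := hQ ω hω
  refine not_reachable_of_isSeparated (hG ω) hmem hrs hδ (by linarith) hf hfM hF
    (fun y hy => ?_) hsep hj htree.2
  obtain ⟨h1, h2⟩ := hor y hy
  have h3 := kde_nonneg hK hh (fun i => X i ω) y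
  have h4 := le_csSup (bddAbove_kde hK hh (fun i => X i ω) 𝒳) (Set.mem_image_of_mem _ hy)
  have h5 := mul_le_mul_of_nonneg_left h4 hε.le
  rw [abs_lt]
  constructor <;> linarith
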